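/- There is an absolute constant $C>0$ such that the following holds. Let $\mathcal X$ be a finite set equipped with a probability measure $\mathrm P$, let $\mathcal R\subseteq 2^{\mathcal X}$ be a family of measurable sets, and suppose that the range space $(\mathcal X,\mathcal R)$ has VC-dimension $d\ge 1$, i.e. $d$ is the maximal size of a set $Y\subseteq\mathcal X$ with $\{R\cap Y: R\in\mathcal R\}=2^Y$. For a family $\mathcal F\subseteq\mathcal R$ and $r>0$ let $\mathcal M(\mathcal F,r)$ be the maximal size of a subfamily $\mathcal Q\subseteq\mathcal F$ such that $\mathrm P(R_1\Delta R_2)\ge r$ for all distinct $R_1,R_2\in\mathcal Q$. Let $\epsilon>0$ and let the real number $D_\epsilon$ be any upper bound on the doubling constant $$\sup_{\epsilon_0\ge\epsilon}\mathcal M\big(\{R\in\mathcal R:\mathrm P(R)\le 2\epsilon_0\},\,\epsilon_0\big).$$ Then there is an $\epsilon$-net for $(\mathcal X,\mathcal R)$, i.e. a set $S\subseteq\mathcal X$ contained in the support of $\mathrm P$ that intersects every $R\in\mathcal R$ with $\mathrm P(R)\ge\epsilon$, of size $$|S|\le C\cdot\frac1\epsilon\big(d+\log D_\epsilon\big).$$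 -/

import Mathlib

open MeasureTheory

noncomputable section

namespace RangeSpace

variable {X : Type*}

/-- `Y` is shattered by `𝓡`: the traces `R ∩ Y`, `R ∈ 𝓡`, are exactly all the subsets of `Y`. -/
def IsShattered (𝓡 : Set (Set X)) (Y : Set X) : Prop :=
  (fun R => R ∩ Y) '' 𝓡 = 𝒫 Y

/-- The VC-dimension of a family of subsets of a finite set: the maximal size of a
shattered set. (The family of sizes is bounded, see `bddAbove_shattered`.) -/
def vcDim (𝓡 : Set (Set X)) : ℕ :=
  sSup {n : ℕ | ∃ Y : Finset X, IsShattered 𝓡 (Y : Set X) ∧ Y.card = n}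

variable [MeasurableSpace X]

/-- The distance `ρ(A, B) = P(A Δ B)`. -/
def rho (P : Measure X) (A B : Set X) : ℝ :=
  P.real (symmDiff A B)

/-- `𝓠` is an `ε`-packing: distinct members are at distance at least `ε`. -/
def IsPacking (P : Measure X) (ε : ℝ) (𝓠 : Set (Set X)) : Prop :=
  𝓠.Pairwise fun A B => ε ≤ rho P A B

/-- The packing number `𝓜(𝓡, ε)`: the maximal size of an `ε`-packing contained in `𝓡`.
(For finite `X` the sizes are bounded, see `bddAbove_packing`.) -/
def packingNumber (P : Measure X) (𝓡 : Set (Set X)) (ε : ℝ) : ℕ :=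
  sSup {n : ℕ | ∃ 𝓠 : Finset (Set X),
    (𝓠 : Set (Set X)) ⊆ 𝓡 ∧ IsPacking P ε (𝓠 : Set (Set X)) ∧ 𝓠.card = n}

/-- `𝓡_{≤ r}`, the ranges of measure at most `r`. -/
def rangesLE (P : Measure X) (𝓡 : Set (Set X)) (r : ℝ) : Set (Set X) :=
  {R ∈ 𝓡 | P.real R ≤ r}

/-- The doubling constant `D_ε(P, 𝓡) = sup_{ε₀ ≥ ε} 𝓜(𝓡_{≤ 2 ε₀}, ε₀)`.
(For finite `X` the supremum is over a bounded set, see `bddAbove_doubling`.) -/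
def doublingConstant (P : Measure X) (𝓡 : Set (Set X)) (ε : ℝ) : ℕ :=
  sSup {n : ℕ | ∃ ε₀ : ℝ, ε ≤ ε₀ ∧ packingNumber P (rangesLE P 𝓡 (2 * ε₀)) ε₀ = n}

/-- The support of a measure on a finite set: the points all of whose measurable
neighbourhoods have positive measure. If singletons are measurable, these are the points
of positive mass, see `mem_supp_iff`. -/
def supp (P : Measure X) : Set X :=
  {x | ∀ A : Set X, MeasurableSet A → x ∈ A → 0 < P A}

/-- `S` is an `ε`-net: it lies in the support of `P` and meets each range of measure at
least `ε`. -/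
def IsEpsNet (P : Measure X) (𝓡 : Set (Set X)) (ε : ℝ) (S : Set X) : Prop :=
  S ⊆ supp P ∧ ∀ R ∈ 𝓡, ε ≤ P.real R → (R ∩ S).Nonempty

theorem mem_supp_iff [MeasurableSingletonClass X] (P : Measure X) (x : X) :
    x ∈ supp P ↔ 0 < P {x} :=
  ⟨fun h => h {x} (measurableSet_singleton x) rfl, fun h _ _ hx =>
    h.trans_le (measure_mono (Set.singleton_subset_iff.2 hx))⟩

theorem bddAbove_shattered {Z : Type*} [Finite Z] (𝓡 : Set (Set Z)) :
    BddAbove {n : ℕ | ∃ Y : Finset Z, IsShattered 𝓡 (Y : Set Z) ∧ Y.card = n} := by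
  have := Fintype.ofFinite Z
  exact ⟨Fintype.card Z, by rintro _ ⟨Y, -, rfl⟩; exact Y.card_le_univ⟩

theorem bddAbove_packing [Finite X] (P : Measure X) (𝓡 : Set (Set X)) (ε : ℝ) :
    BddAbove {n : ℕ | ∃ 𝓠 : Finset (Set X),
      (𝓠 : Set (Set X)) ⊆ 𝓡 ∧ IsPacking P ε (𝓠 : Set (Set X)) ∧ 𝓠.card = n} := by
  have := Fintype.ofFinite (Set X)
  exact ⟨Fintype.card (Set X), by rintro _ ⟨𝓠, -, -, rfl⟩; exact 𝓠.card_le_univ⟩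

theorem bddAbove_doubling [Finite X] (P : Measure X) (𝓡 : Set (Set X)) (ε : ℝ) :
    BddAbove {n : ℕ | ∃ ε₀ : ℝ, ε ≤ ε₀ ∧
      packingNumber P (rangesLE P 𝓡 (2 * ε₀)) ε₀ = n} := by
  have := Fintype.ofFinite (Set X)
  refine ⟨Fintype.card (Set X), ?_⟩
  rintro _ ⟨ε₀, -, rfl⟩
  exact csSup_le' (by rintro _ ⟨𝓠, -, -, rfl⟩; exact 𝓠.card_le_univ)

end RangeSpace

end

namespace RangeSpace

open Finset Classical

/-! Split the ranges into dyadic levels, measure in `[e, 2e]` with `e = 2 ^ k * ε`, and take a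
maximal `e`-packing of each level: at most `D` sets. Every `R` of the level is closer than `e` to a
member `Q`, so `R ∩ Q` has measure at least `e / 2` inside a set of measure at most `2e`
(`half_le_inter`). It suffices to hit these traces. For fixed `Q`, `N` random points miss one with
probability at most `16 ^ d * exp (-N e / 10)`, without a factor `log (1 / e)`
(`sum_missed_inter_le`). This is double sampling (`sum_missHit_le`), with traces counted only on the
sample points inside `Q`, about `N e` of them. A union bound over the `D` sets of each level then
converges geometrically over the levels (`level_bound`). -/

/-- Sauer–Shelah with a free parameter: each shattered set has weight `l ^ (#Y - d) ≥ 1`, and the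
binomial theorem sums the weights. The exponential form in `#V` can be averaged over independent
points. -/
theorem card_le_of_vcDim_le {X : Type*} (𝒯 : Finset (Finset X)) (V : Finset X)
    (hV : ∀ T ∈ 𝒯, T ⊆ V) (d : ℕ) (hd : 𝒯.vcDim ≤ d) (l : ℝ) (hl : 0 < l) (hl1 : l ≤ 1) :
    (#𝒯 : ℝ) ≤ (1 / l) ^ d * (1 + l) ^ #V := by
  have h1 : (#𝒯 : ℝ) ≤ #𝒯.shatterer := by exact_mod_cast 𝒯.card_le_card_shatterer
  have hsub : 𝒯.shatterer ⊆ V.powerset := by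
    intro Y hY
    rw [mem_shatterer] at hY
    obtain ⟨T, hT, hYT⟩ := hY.exists_superset
    exact mem_powerset.2 (hYT.trans (hV T hT))
  have h2 : (#𝒯.shatterer : ℝ) ≤ ∑ Y ∈ 𝒯.shatterer, (1 / l) ^ d * l ^ #Y := by
    rw [card_eq_sum_ones]
    push_cast
    refine sum_le_sum fun Y hY => ?_
    have hY' : #Y ≤ d := ((mem_shatterer.1 hY).card_le_vcDim).trans hd
    calc (1 : ℝ) = (1 / l) ^ d * l ^ d := by
          rw [← mul_pow, one_div_mul_cancel hl.ne', one_pow]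
      _ ≤ (1 / l) ^ d * l ^ #Y := by
          gcongr ?_ * ?_
          exact pow_le_pow_of_le_one hl.le hl1 hY'
  have h3 : ∑ Y ∈ 𝒯.shatterer, (1 / l) ^ d * l ^ #Y ≤ ∑ Y ∈ V.powerset, (1 / l) ^ d * l ^ #Y :=
    sum_le_sum_of_subset_of_nonneg hsub fun _ _ _ => by positivity
  have h4 : ∑ Y ∈ V.powerset, l ^ #Y = (1 + l) ^ #V := by
    have := Finset.sum_pow_mul_eq_add_pow l 1 V
    simpa [add_comm] using this
  rw [← mul_sum V.powerset, h4] at h3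
  exact h1.trans (h2.trans h3)

/-! ### Symmetrization by swapping pairs -/

/-- The weight of an ordered pair in the symmetrization argument: the first point has to miss
`T`, and each hit of the second one counts double. -/
noncomputable def missHit {X : Type*} (T : Finset X) (p : X × X) : ℝ :=
  if p.1 ∈ T then 0 else if p.2 ∈ T then 2 else 1

theorem missHit_nonneg {X : Type*} (T : Finset X) (p : X × X) : 0 ≤ missHit T p := by
  unfold missHit; split_ifs <;> norm_num

theorem missHit_add_swap_le {X : Type*} (T : Finset X) (p : X × X) :
    missHit T p + missHit T p.swap ≤ 2 := by
  unfold missHit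
  simp only [Prod.fst_swap, Prod.snd_swap]
  split_ifs <;> norm_num

/-- The points occurring in a sequence of pairs. -/
noncomputable def points {X : Type*} {N : ℕ} (z : Fin N → X × X) : Finset X :=
  univ.image (fun i => (z i).1) ∪ univ.image (fun i => (z i).2)

/-- Swap the pairs selected by `σ`. -/
def swapAt {X : Type*} {N : ℕ} (σ : Fin N → Bool) (z : Fin N → X × X) : Fin N → X × X :=
  fun i => if σ i then (z i).swap else z i

theorem swapAt_swapAt {X : Type*} {N : ℕ} (σ : Fin N → Bool) (z : Fin N → X × X) :
    swapAt σ (swapAt σ z) = z := by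
  funext i
  unfold swapAt
  split_ifs <;> simp

theorem mem_points {X : Type*} {N : ℕ} (z : Fin N → X × X) (a : X) :
    a ∈ points z ↔ ∃ i, (z i).1 = a ∨ (z i).2 = a := by
  simp [points, exists_or]

theorem points_swapAt {X : Type*} {N : ℕ} (σ : Fin N → Bool) (z : Fin N → X × X) :
    points (swapAt σ z) = points z := by
  ext a
  simp only [mem_points, swapAt]
  refine exists_congr fun i => ?_
  split_ifs
  · simp [or_comm]
  · rfl

variable {X : Type*} [Fintype X]

/-- Symmetrization: averaging over swaps bounds the total weight by the expected number of
traces. -/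
theorem sum_missHit_le (u : X × X → ℝ) (hu : ∀ p, 0 ≤ u p) (hus : ∀ p, u p.swap = u p) (N : ℕ)
    (𝒯 : Finset X → Finset (Finset X)) :
    ∑ z : Fin N → X × X, (∏ i, u (z i)) * ∑ T ∈ 𝒯 (points z), ∏ i, missHit T (z i) ≤
      ∑ z : Fin N → X × X, (∏ i, u (z i)) * #(𝒯 (points z)) := by
  set F : (Fin N → X × X) → ℝ := fun z =>
    (∏ i, u (z i)) * ∑ T ∈ 𝒯 (points z), ∏ i, missHit T (z i) with hF
  have hswap : ∀ σ : Fin N → Bool, ∑ z, F (swapAt σ z) = ∑ z, F z := fun σ =>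
    Equiv.sum_comp (Function.Involutive.toPerm (swapAt (X := X) σ) (swapAt_swapAt σ)) F
  have hus' : ∀ (σ : Fin N → Bool) (z : Fin N → X × X),
      ∏ i, u (swapAt σ z i) = ∏ i, u (z i) := by
    intro σ z
    refine prod_congr rfl fun i _ => ?_
    unfold swapAt
    split_ifs
    · exact hus _
    · rfl
  have hT : ∀ (T : Finset X) (z : Fin N → X × X),
      ∑ σ : Fin N → Bool, ∏ i, missHit T (swapAt σ z i) ≤ 2 ^ N := by
    intro T z
    have h := Finset.prod_univ_sum (fun _ : Fin N => (univ : Finset Bool))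
      (fun i b => missHit T (if b then (z i).swap else z i))
    rw [Fintype.piFinset_univ] at h
    unfold swapAt
    rw [← h]
    calc _ ≤ ∏ _i : Fin N, (2 : ℝ) := by
          refine prod_le_prod (fun i _ => sum_nonneg fun _ _ => missHit_nonneg _ _) fun i _ => ?_
          simpa [add_comm] using missHit_add_swap_le T (z i)
      _ = 2 ^ N := by simp
  have key : (2 : ℝ) ^ N * ∑ z, F z ≤
      2 ^ N * ∑ z : Fin N → X × X, (∏ i, u (z i)) * #(𝒯 (points z)) := by
    calc (2 : ℝ) ^ N * ∑ z, F z = ∑ σ : Fin N → Bool, ∑ z, F (swapAt σ z) := by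
          simp [hswap]
      _ = ∑ z, (∏ i, u (z i)) *
            ∑ T ∈ 𝒯 (points z), ∑ σ : Fin N → Bool, ∏ i, missHit T (swapAt σ z i) := by
          rw [sum_comm]
          refine sum_congr rfl fun z _ => ?_
          simp only [hF, hus', points_swapAt]
          rw [← mul_sum, sum_comm]
      _ ≤ ∑ z, (∏ i, u (z i)) * ∑ T ∈ 𝒯 (points z), 2 ^ N := by
          gcongr with z _ T _
          · exact prod_nonneg fun i _ => hu _
          · exact hT T z
      _ = _ := by
          rw [mul_sum]
          refine sum_congr rfl fun z _ => ?_
          rw [sum_const, nsmul_eq_mul]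
          ring
  exact le_of_mul_le_mul_left key (by positivity)

/-! ### Averages over independent samples -/

theorem sum_prod_pow (w : X → ℝ) (hw1 : ∑ x, w x = 1) (A : Finset X) (c : ℝ) (N : ℕ) :
    ∑ x : Fin N → X, ∏ i, (w (x i) * if x i ∈ A then 1 + c else 1) =
      (1 + c * ∑ x ∈ A, w x) ^ N := by
  have h := Finset.prod_univ_sum (fun _ : Fin N => (univ : Finset X))
      (fun _ x => w x * if x ∈ A then 1 + c else 1)
  rw [Fintype.piFinset_univ] at h
  rw [← h, prod_const, card_univ, Fintype.card_fin]
  congr 1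
  have : ∀ x, (w x * if x ∈ A then 1 + c else 1) = w x + if x ∈ A then c * w x else 0 := by
    intro x; split_ifs <;> ring
  simp_rw [this]
  rw [sum_add_distrib, hw1, sum_ite_mem, univ_inter, mul_sum]

theorem sum_pairs {N : ℕ} (f : (Fin N → X) → (Fin N → X) → ℝ) :
    ∑ z : Fin N → X × X, f (fun i => (z i).1) (fun i => (z i).2) = ∑ x, ∑ y, f x y := by
  rw [← Fintype.sum_prod_type']
  exact Equiv.sum_comp (Equiv.arrowProdEquivProdArrow (Fin N) (fun _ => X) (fun _ => X))
    (fun p => f p.1 p.2)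

theorem pow_card_points_le {X : Type*} {N : ℕ} (z : Fin N → X × X) (Q : Finset X) (l : ℝ) (hl : 0 ≤ l) :
    (1 + l) ^ #(points z ∩ Q) ≤
      (∏ i, if (z i).1 ∈ Q then 1 + l else 1) * ∏ i, if (z i).2 ∈ Q then 1 + l else 1 := by
  have hsub : points z ∩ Q ⊆ (univ.filter fun i => (z i).1 ∈ Q).image (fun i => (z i).1) ∪
      (univ.filter fun i => (z i).2 ∈ Q).image (fun i => (z i).2) := by
    intro a ha
    simp only [mem_inter, mem_points] at ha
    obtain ⟨⟨i, hi⟩, haQ⟩ := ha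
    simp only [mem_union, mem_image, mem_filter, mem_univ, true_and]
    rcases hi with hi | hi
    · exact Or.inl ⟨i, hi ▸ haQ, hi⟩
    · exact Or.inr ⟨i, hi ▸ haQ, hi⟩
  have hcard := (card_le_card hsub).trans ((card_union_le _ _).trans
    (add_le_add card_image_le card_image_le))
  have hp : ∀ (p : Fin N → Prop) [DecidablePred p],
      (∏ i, if p i then 1 + l else 1) = (1 + l) ^ #(univ.filter p) := by
    intro p _
    rw [prod_ite]
    simp
  rw [hp, hp, ← pow_add]
  exact pow_le_pow_right₀ (by linarith) hcard

/-- The probability that `N` independent points miss some member of a family of subsets of `Q`,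
each of weight at least `δ`. -/
theorem sum_missed_le (w : X → ℝ) (hw : ∀ x, 0 ≤ w x) (hw1 : ∑ x, w x = 1)
    (𝓕 : Finset (Finset X)) (Q : Finset X) (hQ : ∀ A ∈ 𝓕, A ⊆ Q) (d : ℕ)
    (hd : ∀ Y : Finset X, 𝓕.Shatters Y → #Y ≤ d) (δ : ℝ) (hδ : 0 ≤ δ)
    (hA : ∀ A ∈ 𝓕, δ ≤ ∑ x ∈ A, w x) (l : ℝ) (hl : 0 < l) (hl1 : l ≤ 1) (N : ℕ) :
    (1 + δ) ^ N * ∑ x : Fin N → X, (∏ i, w (x i)) *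
        (if ∃ A ∈ 𝓕, ∀ i, x i ∉ A then 1 else 0) ≤
      (1 / l) ^ d * ((1 + l * ∑ x ∈ Q, w x) ^ N) ^ 2 := by
  set 𝒯 : Finset X → Finset (Finset X) := fun V => 𝓕.image (· ∩ V) with h𝒯
  have hvc : ∀ V, (𝒯 V).vcDim ≤ d := by
    intro V
    -- A set shattered by the traces lies in `V`, so cutting with `V` loses nothing on it.
    refine Finset.sup_le fun Y hY => hd Y ?_
    have hY := mem_shatterer.1 hY
    obtain ⟨T, hT, hYT⟩ := hY.exists_superset
    obtain ⟨B, -, rfl⟩ := mem_image.1 hT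
    intro t ht
    obtain ⟨T', hT', hYT'⟩ := hY ht
    obtain ⟨B', hB', rfl⟩ := mem_image.1 hT'
    refine ⟨B', hB', ?_⟩
    rw [← hYT', inter_comm B' V, ← inter_assoc,
      inter_eq_left.2 (hYT.trans inter_subset_right)]
  set u : X × X → ℝ := fun p => w p.1 * w p.2 with hu
  have step1 : (1 + δ) ^ N * ∑ x : Fin N → X, (∏ i, w (x i)) *
        (if ∃ A ∈ 𝓕, ∀ i, x i ∉ A then 1 else 0) ≤
      ∑ z : Fin N → X × X, (∏ i, u (z i)) * ∑ T ∈ 𝒯 (points z), ∏ i, missHit T (z i) := by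
    have e := sum_pairs (X := X) (N := N) fun x y => (∏ i, u (x i, y i)) *
      ∑ T ∈ 𝒯 (points fun i => (x i, y i)), ∏ i, missHit T (x i, y i)
    simp only [Prod.mk.eta] at e
    rw [e, mul_sum]
    refine sum_le_sum fun x _ => ?_
    have hnn : ∀ y : Fin N → X, ∀ T, 0 ≤ ∏ i, missHit T (x i, y i) := fun y T =>
      prod_nonneg fun i _ => missHit_nonneg _ _
    have hwx : ∀ x : Fin N → X, 0 ≤ ∏ i, w (x i) := fun x => prod_nonneg fun i _ => hw _
    have hux : ∀ y : Fin N → X, 0 ≤ ∏ i, u (x i, y i) := fun y =>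
      prod_nonneg fun i _ => mul_nonneg (hw _) (hw _)
    split_ifs with hx
    -- If `x` misses `A`, the average over `y` of `2 ^ (hits of A)` is `(1 + w(A)) ^ N`.
    · obtain ⟨A, hAF, hxA⟩ := hx
      calc (1 + δ) ^ N * ((∏ i, w (x i)) * 1)
          ≤ (∏ i, w (x i)) * (1 + 1 * ∑ x ∈ A, w x) ^ N := by
            rw [mul_one, mul_comm, one_mul]
            refine mul_le_mul_of_nonneg_left ?_ (hwx x)
            exact pow_le_pow_left₀ (by linarith) (by linarith [hA A hAF]) _
        _ = ∑ y : Fin N → X, (∏ i, u (x i, y i)) * ∏ i, missHit (A ∩ points fun i => (x i, y i))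
              (x i, y i) := by
            rw [← sum_prod_pow w hw1, mul_sum]
            refine sum_congr rfl fun y _ => ?_
            rw [← prod_mul_distrib, ← prod_mul_distrib]
            refine prod_congr rfl fun i _ => ?_
            have hy : y i ∈ points fun i => (x i, y i) := (mem_points _ _).2 ⟨i, Or.inr rfl⟩
            simp only [hu, missHit, mem_inter, hxA i, hy, false_and, if_false, and_true]
            split_ifs <;> ring
        _ ≤ _ := by
            refine sum_le_sum fun y _ => mul_le_mul_of_nonneg_left ?_ (hux y)
            exact single_le_sum (f := fun T => ∏ i, missHit T (x i, y i)) (fun T _ => hnn y T)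
              (mem_image_of_mem _ hAF)
    · rw [mul_zero, mul_zero]
      exact sum_nonneg fun y _ => mul_nonneg (hux y) (sum_nonneg fun T _ => hnn y T)
  have step2 := sum_missHit_le u (fun p => mul_nonneg (hw _) (hw _))
    (fun p => by simp [hu, mul_comm]) N 𝒯
  have step3 : ∑ z : Fin N → X × X, (∏ i, u (z i)) * (#(𝒯 (points z)) : ℝ) ≤
      (1 / l) ^ d * ((1 + l * ∑ x ∈ Q, w x) ^ N) ^ 2 := by
    calc _ ≤ ∑ z : Fin N → X × X, (1 / l) ^ d *
          ((∏ i, (w (z i).1 * if (z i).1 ∈ Q then 1 + l else 1)) *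
            ∏ i, (w (z i).2 * if (z i).2 ∈ Q then 1 + l else 1)) := by
          refine sum_le_sum fun z _ => ?_
          have hc := card_le_of_vcDim_le (𝒯 (points z)) (points z ∩ Q) (by
            intro T hT
            obtain ⟨A, hA, rfl⟩ := mem_image.1 hT
            exact subset_inter inter_subset_right (inter_subset_left.trans (hQ A hA)))
            d (hvc _) l hl hl1
          have hp := pow_card_points_le z Q l hl.le
          calc (∏ i, u (z i)) * (#(𝒯 (points z)) : ℝ) ≤ (∏ i, u (z i)) * ((1 / l) ^ d *
              ((∏ i, if (z i).1 ∈ Q then 1 + l else 1) *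
                ∏ i, if (z i).2 ∈ Q then 1 + l else 1)) := by
                refine mul_le_mul_of_nonneg_left (hc.trans ?_)
                  (prod_nonneg fun i _ => mul_nonneg (hw _) (hw _))
                exact mul_le_mul_of_nonneg_left hp (by positivity)
            _ = _ := by
                simp only [hu, prod_mul_distrib]
                ring
      _ = _ := by
          rw [← mul_sum, sum_pairs (fun x y => (∏ i, (w (x i) * if x i ∈ Q then 1 + l else 1)) *
            ∏ i, (w (y i) * if y i ∈ Q then 1 + l else 1))]
          simp_rw [← mul_sum]
          rw [← sum_mul, sum_prod_pow w hw1]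
          ring
  exact step1.trans (step2.trans step3)

/-! ### Point weights, packings and traces -/

/-- A measure on a finite set is given by point weights, which may be chosen to vanish outside
of the support even if singletons are not measurable. -/
theorem exists_weights {X : Type*} [Fintype X] [MeasurableSpace X] (P : Measure X)
    [IsProbabilityMeasure P] :
    ∃ w : X → ℝ, (∀ x, 0 ≤ w x) ∧
      (∀ A : Set X, MeasurableSet A → P.real A = ∑ x ∈ A.toFinset, w x) ∧
      ∀ x, 0 < w x → x ∈ supp P := by
  have hne : ∀ x : X, (measurableAtom x).Nonempty := fun x => ⟨x, mem_measurableAtom_self x⟩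
  set f : Set X → X → X := fun S x => if h : S.Nonempty then h.some else x with hf
  -- `r` selects one point per measurable atom; that point will carry the whole mass of its atom.
  obtain ⟨r, hr, hrc⟩ : ∃ r : X → X, (∀ x, r x ∈ measurableAtom x) ∧
      ∀ x y, measurableAtom x = measurableAtom y → r x = r y := by
    refine ⟨fun x => f (measurableAtom x) x, fun x => ?_, fun x y h => ?_⟩
    · simp only [hf, dif_pos (hne x)]
      exact (hne x).some_mem
    · simp only [hf, dif_pos (hne y), h]
  have hmem : ∀ (A : Set X), MeasurableSet A → ∀ x, r x ∈ A ↔ x ∈ A := by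
    intro A hA x
    constructor
    · intro h
      have : x ∈ measurableAtom (r x) := by
        rw [measurableAtom_eq_of_mem (hr x)]
        exact mem_measurableAtom_self x
      exact mem_of_mem_measurableAtom this hA h
    · exact fun h => mem_of_mem_measurableAtom (hr x) hA h
  have hmeas : ∀ x, MeasurableSet (r ⁻¹' {x}) := by
    intro x
    have : r ⁻¹' {x} = ⋃ y ∈ r ⁻¹' {x}, measurableAtom y := by
      ext z
      simp only [Set.mem_iUnion, exists_prop]
      constructor
      · exact fun h => ⟨z, h, mem_measurableAtom_self z⟩
      · rintro ⟨y, hy, hz⟩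
        have := hrc z y (measurableAtom_eq_of_mem hz)
        exact this.trans hy
    rw [this]
    exact MeasurableSet.biUnion (Set.to_countable _) fun y _ =>
      MeasurableSet.measurableAtom_of_countable y
  refine ⟨fun x => P.real (r ⁻¹' {x}), fun x => measureReal_nonneg, fun A hA => ?_,
    fun x hx A hA hxA => ?_⟩
  · have : A = ⋃ x ∈ A.toFinset, r ⁻¹' {x} := by
      ext z
      simp [hmem A hA]
    conv_lhs => rw [this]
    refine measureReal_biUnion_finset (fun x _ y _ hxy => ?_) fun x _ => hmeas x
    exact Disjoint.preimage r (Set.disjoint_singleton.2 hxy)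
  · have hsub : r ⁻¹' {x} ⊆ A := by
      intro y hy
      rw [← hmem A hA, show r y = x from hy]
      exact hxA
    exact (ENNReal.toReal_pos_iff.1 hx).1.trans_le (measure_mono hsub)

/-- Two families are needed: the packing must consist of sets bounded below in measure, while the
doubling constant only bounds measures above. -/
theorem exists_maximal_packing {X : Type*} [Finite X] [MeasurableSpace X] (P : Measure X)
    {𝓖 𝓗 : Set (Set X)} (h : 𝓖 ⊆ 𝓗) {ε : ℝ} (hε : 0 < ε) :
    ∃ 𝓠 : Finset (Set X), (𝓠 : Set (Set X)) ⊆ 𝓖 ∧ #𝓠 ≤ packingNumber P 𝓗 ε ∧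
      ∀ R ∈ 𝓖, ∃ Q ∈ 𝓠, rho P R Q < ε := by
  obtain ⟨𝓠, h𝓠⟩ := Set.Finite.exists_maximal
    (s := {𝓠 : Finset (Set X) | (𝓠 : Set (Set X)) ⊆ 𝓖 ∧ IsPacking P ε (𝓠 : Set (Set X))})
    (Set.toFinite _) ⟨∅, by simp, by simp [IsPacking]⟩
  refine ⟨𝓠, h𝓠.prop.1, le_csSup (bddAbove_packing P 𝓗 ε) ⟨𝓠, h𝓠.prop.1.trans h, h𝓠.prop.2, rfl⟩,
    fun R hR => ?_⟩
  by_contra! hcon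
  have hins : insert R 𝓠 ⊆ 𝓠 := by
    refine h𝓠.le_of_ge (y := insert R 𝓠) ⟨?_, ?_⟩ (subset_insert R 𝓠)
    · rw [coe_insert]
      exact Set.insert_subset hR h𝓠.prop.1
    · rw [coe_insert]
      refine Set.Pairwise.insert h𝓠.prop.2 fun Q hQ _ => ⟨hcon Q hQ, ?_⟩
      have := hcon Q hQ
      rwa [rho, symmDiff_comm] at this
  have := hcon R (hins (mem_insert_self R 𝓠))
  simp only [rho, symmDiff_self, Set.bot_eq_empty, measureReal_empty] at this
  linarith

/-- `2 P(R ∩ Q) = P(R) + P(Q) - P(R Δ Q) > e + e - e`. -/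
theorem half_le_inter {X : Type*} [MeasurableSpace X] (P : Measure X) [IsProbabilityMeasure P]
    {R Q : Set X} (hR : MeasurableSet R) (hQ : MeasurableSet Q) {e : ℝ} (heR : e ≤ P.real R)
    (heQ : e ≤ P.real Q) (h : rho P R Q < e) : e / 2 ≤ P.real (R ∩ Q) := by
  have h1 := measureReal_inter_add_sdiff (μ := P) (s := R) hQ
  have h2 := measureReal_inter_add_sdiff (μ := P) (s := Q) hR
  rw [Set.inter_comm] at h2
  have h3 : rho P R Q = P.real (R \ Q) + P.real (Q \ R) := by
    rw [rho, Set.symmDiff_def]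
    exact measureReal_union (disjoint_sdiff_sdiff) (hQ.diff hR)
  linarith

theorem card_le_vcDim {X : Type*} [Finite X] {𝓡 : Set (Set X)} {Y : Finset X}
    (h : ∀ t ⊆ Y, ∃ R ∈ 𝓡, R ∩ (Y : Set X) = t) : #Y ≤ vcDim 𝓡 := by
  refine le_csSup (bddAbove_shattered 𝓡) ⟨Y, ?_, rfl⟩
  ext t
  constructor
  · rintro ⟨R, -, rfl⟩
    exact Set.inter_subset_right
  · intro ht
    lift t to Finset X using Set.toFinite t
    exact h t (by exact_mod_cast ht)

/-- The probability that independent points miss a range in a heavy part of `Q`. -/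
theorem sum_missed_inter_le {X : Type*} [Fintype X] (𝓡 : Set (Set X)) (w : X → ℝ)
    (hw : ∀ x, 0 ≤ w x) (hw1 : ∑ x, w x = 1) (Q : Set X) {e : ℝ} (he : 0 < e) (he1 : e ≤ 1)
    (hQ : ∑ x ∈ Q.toFinset, w x ≤ 2 * e) (N : ℕ) :
    ∑ x : Fin N → X, (∏ i, w (x i)) *
        (if ∃ R ∈ 𝓡, e / 2 ≤ ∑ x ∈ (R ∩ Q).toFinset, w x ∧ ∀ i, x i ∉ R ∩ Q then 1 else 0) ≤
      (16 : ℝ) ^ vcDim 𝓡 * Real.exp (-(N * e / 10)) := by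
  set 𝓕 : Finset (Finset X) := univ.filter fun A =>
    (∃ R ∈ 𝓡, A = (R ∩ Q).toFinset) ∧ e / 2 ≤ ∑ x ∈ A, w x with h𝓕
  have hsub : ∀ A ∈ 𝓕, A ⊆ Q.toFinset := by
    intro A hA
    obtain ⟨⟨R, -, rfl⟩, -⟩ := (mem_filter.1 hA).2
    exact Set.toFinset_subset_toFinset.2 Set.inter_subset_right
  have hvc : ∀ Y : Finset X, 𝓕.Shatters Y → #Y ≤ vcDim 𝓡 := by
    intro Y hY
    refine card_le_vcDim fun t ht => ?_
    obtain ⟨B, hB, hYB⟩ := hY.exists_superset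
    obtain ⟨A, hA, rfl⟩ := hY ht
    obtain ⟨⟨R, hR, rfl⟩, -⟩ := (mem_filter.1 hA).2
    refine ⟨R, hR, ?_⟩
    have hYQ : Y ⊆ Q.toFinset := hYB.trans (hsub B hB)
    ext x
    simp only [Set.mem_inter_iff, mem_coe, mem_inter, Set.mem_toFinset]
    constructor
    · exact fun h => ⟨h.2, h.1, Set.mem_toFinset.1 (hYQ h.2)⟩
    · exact fun h => ⟨h.2.1, h.1⟩
  -- With `l = 1 / 16` the trace count grows like `(1 + e / 8) ^ (2 * N)`, which loses to the gain
  -- `(1 + e / 2) ^ N`.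
  have main := sum_missed_le w hw hw1 𝓕 Q.toFinset hsub (vcDim 𝓡) hvc (e / 2) (by positivity)
    (fun A hA => (mem_filter.1 hA).2.2) (1 / 16) (by norm_num) (by norm_num) N
  have hev : ∀ x : Fin N → X, (∃ A ∈ 𝓕, ∀ i, x i ∉ A) ↔
      ∃ R ∈ 𝓡, e / 2 ≤ ∑ x ∈ (R ∩ Q).toFinset, w x ∧ ∀ i, x i ∉ R ∩ Q := by
    intro x
    constructor
    · rintro ⟨A, hA, hx⟩
      obtain ⟨⟨R, hR, rfl⟩, hAe⟩ := (mem_filter.1 hA).2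
      exact ⟨R, hR, hAe, fun i hi => hx i (Set.mem_toFinset.2 hi)⟩
    · rintro ⟨R, hR, hRe, hx⟩
      exact ⟨_, mem_filter.2 ⟨mem_univ _, ⟨R, hR, rfl⟩, hRe⟩,
        fun i hi => hx i (Set.mem_toFinset.1 hi)⟩
  simp_rw [hev] at main
  have hpos : 0 < (1 + e / 2) ^ N := by positivity
  refine le_of_mul_le_mul_left (main.trans ?_) hpos
  have hq0 : 0 ≤ ∑ x ∈ Q.toFinset, w x := sum_nonneg fun x _ => hw x
  have hbase : (1 + 1 / 16 * ∑ x ∈ Q.toFinset, w x) ^ 2 ≤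
      (1 + e / 2) * Real.exp (-(e / 10)) := by
    have h1 : (1 + 1 / 16 * ∑ x ∈ Q.toFinset, w x) ^ 2 ≤ (1 + e / 8) ^ 2 :=
      pow_le_pow_left₀ (by positivity) (by linarith) 2
    have h2 : (1 + e / 8) ^ 2 ≤ (1 + e / 2) * (1 - e / 10) := by nlinarith
    have h3 : 1 - e / 10 ≤ Real.exp (-(e / 10)) := by
      linarith [Real.add_one_le_exp (-(e / 10))]
    exact h1.trans (h2.trans (mul_le_mul_of_nonneg_left h3 (by positivity)))
  calc (1 / (1 / 16 : ℝ)) ^ vcDim 𝓡 * ((1 + 1 / 16 * ∑ x ∈ Q.toFinset, w x) ^ N) ^ 2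
      = 16 ^ vcDim 𝓡 * ((1 + 1 / 16 * ∑ x ∈ Q.toFinset, w x) ^ 2) ^ N := by
        rw [← pow_mul, ← pow_mul, mul_comm N 2]
        norm_num
    _ ≤ 16 ^ vcDim 𝓡 * ((1 + e / 2) * Real.exp (-(e / 10))) ^ N := by gcongr
    _ = (1 + e / 2) ^ N * (16 ^ vcDim 𝓡 * Real.exp (-(N * e / 10))) := by
        rw [mul_pow, ← Real.exp_nat_mul]
        ring_nf

/-! ### Union bound over the levels -/

theorem one_le_doublingConstant {X : Type*} [Finite X] [MeasurableSpace X] (P : Measure X)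
    [IsProbabilityMeasure P] {𝓡 : Set (Set X)} (h : 𝓡.Nonempty) (ε : ℝ) :
    1 ≤ doublingConstant P 𝓡 ε := by
  obtain ⟨R, hR⟩ := h
  have h1 : 1 ≤ packingNumber P (rangesLE P 𝓡 (2 * max ε 1)) (max ε 1) := by
    refine le_csSup (bddAbove_packing _ _ _) ⟨{R}, ?_, ?_, card_singleton R⟩
    · rw [coe_singleton, Set.singleton_subset_iff]
      exact ⟨hR, measureReal_le_one.trans (by linarith [le_max_right ε 1])⟩
    · rw [coe_singleton]
      exact Set.pairwise_singleton _ _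
  exact h1.trans (le_csSup (bddAbove_doubling P 𝓡 ε) ⟨_, le_max_left _ _, rfl⟩)

theorem nonempty_of_one_le_vcDim {X : Type*} {𝓡 : Set (Set X)} (h : 1 ≤ vcDim 𝓡) :
    𝓡.Nonempty := by
  by_contra hne
  rw [Set.not_nonempty_iff_eq_empty] at hne
  subst hne
  have : {n : ℕ | ∃ Y : Finset X, IsShattered (∅ : Set (Set X)) (Y : Set X) ∧ Y.card = n} = ∅ := by
    ext n
    simp only [IsShattered, Set.image_empty, Set.mem_ofPred_eq, Set.mem_empty_iff_false, iff_false]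
    rintro ⟨Y, hY, -⟩
    exact (Set.powerset_nonempty (s := (Y : Set X))).ne_empty hY.symm
  rw [vcDim, this] at h
  simp at h

/-- With `t = d + log D ≥ 1` and `2 ^ k ≥ k + 1`, the exponent is at most `3t - 4t(k + 1) ≤ -(k +
1)`. -/
theorem level_bound {d : ℕ} (hd : 1 ≤ d) {D : ℝ} (hD : 1 ≤ D) {s : ℝ}
    (hs : 40 * ((d : ℝ) + Real.log D) ≤ s) (k : ℕ) :
    D * ((16 : ℝ) ^ d * Real.exp (-(s * 2 ^ k / 10))) ≤ (1 / 2) ^ (k + 1) := by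
  have hd' : (1 : ℝ) ≤ d := by exact_mod_cast hd
  have hlog := Real.log_nonneg hD
  have h16 : (16 : ℝ) ≤ Real.exp 3 := by
    have h := Real.exp_one_gt_d9
    calc (16 : ℝ) ≤ 2.7 ^ 3 := by norm_num
      _ ≤ Real.exp 1 ^ 3 := by gcongr; linarith
      _ = Real.exp 3 := by rw [← Real.exp_nat_mul]; norm_num
  have hhalf : Real.exp (-1) ≤ 1 / 2 := by
    rw [Real.exp_neg, one_div]
    gcongr
    linarith [Real.exp_one_gt_d9]
  have hk : (k : ℝ) + 1 ≤ 2 ^ k := by exact_mod_cast Nat.lt_two_pow_self (n := k)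
  calc D * ((16 : ℝ) ^ d * Real.exp (-(s * 2 ^ k / 10)))
      ≤ Real.exp (Real.log D) * (Real.exp 3 ^ d * Real.exp (-(s * 2 ^ k / 10))) := by
        rw [Real.exp_log (by linarith)]
        gcongr
    _ = Real.exp (Real.log D + d * 3 - s * 2 ^ k / 10) := by
        rw [← Real.exp_nat_mul, ← Real.exp_add, ← Real.exp_add]
        ring_nf
    _ ≤ Real.exp (((k + 1 : ℕ) : ℝ) * (-1)) := by
        refine Real.exp_le_exp.2 ?_
        have hk0 : (0 : ℝ) ≤ k := k.cast_nonneg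
        have : 40 * ((d : ℝ) + Real.log D) * (k + 1) ≤ s * 2 ^ k :=
          mul_le_mul hs hk (by positivity) (le_trans (by positivity) hs)
        push_cast
        nlinarith [mul_nonneg hk0 (by linarith : (0 : ℝ) ≤ d + Real.log D - 1)]
    _ = Real.exp (-1) ^ (k + 1) := Real.exp_nat_mul _ _
    _ ≤ (1 / 2) ^ (k + 1) := by gcongr

theorem exists_epsNet {X : Type*} [Finite X] [MeasurableSpace X] (P : Measure X)
    [IsProbabilityMeasure P] (𝓡 : Set (Set X)) (h𝓡 : ∀ R ∈ 𝓡, MeasurableSet R)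
    (hd : 1 ≤ vcDim 𝓡) {ε : ℝ} (hε : 0 < ε) (hε1 : ε ≤ 1) {D : ℝ}
    (hD : (doublingConstant P 𝓡 ε : ℝ) ≤ D) (N : ℕ)
    (hN : 40 * ((vcDim 𝓡 : ℝ) + Real.log D) ≤ N * ε) :
    ∃ S : Finset X, IsEpsNet P 𝓡 ε (S : Set X) ∧ #S ≤ N := by
  have := Fintype.ofFinite X
  have hD1 : 1 ≤ D := by
    have := one_le_doublingConstant P (nonempty_of_one_le_vcDim hd) ε
    exact le_trans (by exact_mod_cast this) hD
  obtain ⟨w, hw, hwP, hws⟩ := exists_weights P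
  have hw1 : ∑ x, w x = 1 := by
    have := hwP Set.univ MeasurableSet.univ
    simpa using this.symm
  -- As `P ≤ 1`, the levels `0, ..., K` cover all ranges of measure at least `ε`.
  obtain ⟨K, hK, hK'⟩ := exists_nat_pow_near (one_le_one_div hε hε1) (one_lt_two (α := ℝ))
  choose 𝓠 h𝓠 hcard hcover using fun k : ℕ => exists_maximal_packing P
    (𝓖 := {R ∈ 𝓡 | 2 ^ k * ε ≤ P.real R ∧ P.real R ≤ 2 * (2 ^ k * ε)})
    (𝓗 := rangesLE P 𝓡 (2 * (2 ^ k * ε))) (fun R hR => ⟨hR.1, hR.2.2⟩)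
    (by positivity : 0 < 2 ^ k * ε)
  have hcardD : ∀ k, (#(𝓠 k) : ℝ) ≤ D := by
    intro k
    refine le_trans ?_ hD
    exact_mod_cast (hcard k).trans (le_csSup (bddAbove_doubling P 𝓡 ε)
      ⟨_, le_mul_of_one_le_left hε.le (one_le_pow₀ one_le_two), rfl⟩)
  set bad : ℕ → Set X → (Fin N → X) → ℝ := fun k Q x =>
    if ∃ R ∈ 𝓡, 2 ^ k * ε / 2 ≤ ∑ x ∈ (R ∩ Q).toFinset, w x ∧ ∀ i, x i ∉ R ∩ Q then 1 else 0
    with hbad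
  have hbad0 : ∀ k Q x, 0 ≤ bad k Q x := by
    intro k Q x
    simp only [hbad]
    split_ifs <;> norm_num
  have hlevel : ∀ k ∈ range (K + 1), ∑ Q ∈ 𝓠 k, ∑ x, (∏ i, w (x i)) * bad k Q x ≤
      (1 / 2 : ℝ) ^ (k + 1) := by
    intro k hk
    have he1 : 2 ^ k * ε ≤ 1 := by
      rw [← le_div_iff₀ hε]
      exact (pow_le_pow_right₀ one_le_two (Nat.lt_succ_iff.1 (mem_range.1 hk))).trans hK
    calc _ ≤ ∑ Q ∈ 𝓠 k, (16 : ℝ) ^ vcDim 𝓡 * Real.exp (-(N * (2 ^ k * ε) / 10)) := by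
          refine sum_le_sum fun Q hQ => ?_
          have hQ' := h𝓠 k hQ
          refine sum_missed_inter_le 𝓡 w hw hw1 Q (by positivity) he1 ?_ N
          rw [← hwP Q (h𝓡 Q hQ'.1)]
          exact hQ'.2.2
      _ ≤ D * ((16 : ℝ) ^ vcDim 𝓡 * Real.exp (-(N * ε * 2 ^ k / 10))) := by
          rw [sum_const, nsmul_eq_mul, mul_left_comm (N : ℝ), mul_comm (2 ^ k : ℝ) (N * ε)]
          exact mul_le_mul_of_nonneg_right (hcardD k) (by positivity)
      _ ≤ _ := level_bound hd hD1 hN k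
  have hgeom : ∀ n : ℕ, ∑ k ∈ range n, (1 / 2 : ℝ) ^ (k + 1) < 1 := by
    intro n
    have : ∑ k ∈ range n, (1 / 2 : ℝ) ^ (k + 1) = 1 - (1 / 2) ^ n := by
      induction n with
      | zero => simp
      | succ n ih => rw [sum_range_succ, ih]; ring
    rw [this]
    linarith [pow_pos (one_half_pos (α := ℝ)) n]
  have htotal : ∑ x : Fin N → X, (∏ i, w (x i)) *
      ∑ k ∈ range (K + 1), ∑ Q ∈ 𝓠 k, bad k Q x < ∑ x : Fin N → X, ∏ i, w (x i) := by
    have h1 : ∑ x : Fin N → X, ∏ i, w (x i) = 1 := by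
      have := sum_prod_pow w hw1 ∅ 0 N
      simpa using this
    rw [h1]
    refine lt_of_eq_of_lt ?_ ((sum_le_sum hlevel).trans_lt (hgeom (K + 1)))
    simp_rw [mul_sum]
    rw [sum_comm]
    exact sum_congr rfl fun k _ => sum_comm
  -- Strictness forces the sample to have positive weight, hence to lie in the support, and leaves
  -- no bad event.
  obtain ⟨x, -, hx⟩ := exists_lt_of_sum_lt htotal
  have hwx : 0 ≤ ∏ i, w (x i) := prod_nonneg fun i _ => hw _
  have hwx0 : ∏ i, w (x i) ≠ 0 := by
    intro h
    simp [h] at hx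
  have hxbad : ∑ k ∈ range (K + 1), ∑ Q ∈ 𝓠 k, bad k Q x < 1 := by
    by_contra! hcon
    exact absurd hx (not_lt.2 (le_mul_of_one_le_right hwx hcon))
  refine ⟨univ.image x, ⟨?_, fun R hR hRε => ?_⟩, card_image_le.trans (by simp)⟩
  · intro a ha
    obtain ⟨i, -, rfl⟩ := mem_image.1 (mem_coe.1 ha)
    exact hws _ (lt_of_le_of_ne (hw _) fun h => hwx0 (prod_eq_zero (mem_univ i) h.symm))
  · obtain ⟨k, hk, hk'⟩ := exists_nat_pow_near ((one_le_div hε).2 hRε) (one_lt_two (α := ℝ))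
    have hkK : k ∈ range (K + 1) := by
      have h1 : P.real R / ε ≤ 1 / ε := by gcongr; exact measureReal_le_one
      exact mem_range.2 ((pow_lt_pow_iff_right₀ (one_lt_two (α := ℝ))).1
        (hk.trans_lt (h1.trans_lt hK')))
    rw [le_div_iff₀ hε] at hk
    rw [div_lt_iff₀ hε, pow_succ'] at hk'
    obtain ⟨Q, hQ, hRQ⟩ := hcover k R ⟨hR, hk, by linarith⟩
    have hQ' := h𝓠 k hQ
    have hinter := half_le_inter P (h𝓡 R hR) (h𝓡 Q hQ'.1) hk hQ'.2.1 hRQ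
    rw [hwP _ ((h𝓡 R hR).inter (h𝓡 Q hQ'.1))] at hinter
    by_contra hmiss
    have hb : bad k Q x = 1 := by
      refine if_pos ⟨R, hR, by convert hinter, fun i hi => hmiss ⟨x i, hi.1, ?_⟩⟩
      exact mem_coe.2 (mem_image_of_mem x (mem_univ i))
    have h1 := single_le_sum (f := fun Q => bad k Q x) (fun Q _ => hbad0 k Q x) hQ
    have h2 := single_le_sum (f := fun k => ∑ Q ∈ 𝓠 k, bad k Q x)
      (fun k _ => sum_nonneg fun Q _ => hbad0 k Q x) hkK
    exact absurd (hb.ge.trans (h1.trans h2)) (not_le.2 hxbad)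

end RangeSpace

theorem corollary6 :
    ∃ C : ℝ, 0 < C ∧
      ∀ (X : Type*) [Finite X] [MeasurableSpace X] (P : Measure X) [IsProbabilityMeasure P]
        (𝓡 : Set (Set X)) (_ : ∀ R ∈ 𝓡, MeasurableSet R)
        (d : ℕ) (_ : 1 ≤ d) (_ : RangeSpace.vcDim 𝓡 = d)
        (ε : ℝ) (_ : 0 < ε)
        (D : ℝ) (_ : (RangeSpace.doublingConstant P 𝓡 ε : ℝ) ≤ D),
        ∃ S : Finset X, RangeSpace.IsEpsNet P 𝓡 ε (S : Set X) ∧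
          (S.card : ℝ) ≤ C * ((1 / ε) * ((d : ℝ) + Real.log D)) := by
  refine ⟨41, by norm_num, ?_⟩
  rintro X _ _ P _ 𝓡 h𝓡 d hd rfl ε hε D hD
  have hD1 : 1 ≤ D := by
    have := RangeSpace.one_le_doublingConstant P (RangeSpace.nonempty_of_one_le_vcDim hd) ε
    exact le_trans (by exact_mod_cast this) hD
  have hd' : (1 : ℝ) ≤ RangeSpace.vcDim 𝓡 := by exact_mod_cast hd
  have hlog := Real.log_nonneg hD1
  rcases le_or_gt ε 1 with hε1 | hε1
  · set t := (RangeSpace.vcDim 𝓡 : ℝ) + Real.log D with ht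
    have hN := Nat.le_ceil (40 * t / ε)
    rw [div_le_iff₀ hε] at hN
    obtain ⟨S, hS, hcard⟩ := RangeSpace.exists_epsNet P 𝓡 h𝓡 hd hε hε1 hD _ hN
    refine ⟨S, hS, ?_⟩
    have hceil := Nat.ceil_lt_add_one (a := 40 * t / ε) (by positivity)
    -- `t ≥ 1 ≥ ε` absorbs the rounding, turning 40 into 41.
    have h1 : 1 ≤ t / ε := (one_le_div hε).2 (by linarith)
    calc (S.card : ℝ) ≤ (⌈40 * t / ε⌉₊ : ℝ) := by exact_mod_cast hcard
      _ ≤ 40 * t / ε + t / ε := by linarith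
      _ = 41 * (1 / ε * t) := by ring
  · refine ⟨∅, ⟨by simp, fun R _ hR => ?_⟩, ?_⟩
    · exact absurd (hR.trans measureReal_le_one) (not_le.2 hε1)
    · rw [Finset.card_empty, Nat.cast_zero]
      positivity
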